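/- All graphs are finite and simple. For a graph $G$ with Laplacian $L = D - A$, let $U_G(t) = \exp(-itL)$ for $t\in\mathbb{R}$, and let $e_u$ be the characteristic vector of a vertex $u$. $G$ has \emph{Laplacian perfect state transfer} between $u$ and $v$ if $U_G(\tau)e_u = \gamma e_v$ for some $\tau \in \mathbb{R}$ and $\gamma \in \mathbb{C}$, and \emph{Laplacian pretty good state transfer} between $u$ and $v$ if for every $\epsilon > 0$ there are $t \in \mathbb{R}$ and $\gamma \in \mathbb{C}$ with $\|U_G(t)e_u - \gamma e_v\| < \epsilon$ in the Euclidean norm. The \emph{eigenvalue support} of $u$ is the set of eigenvalues $\lambda$ of $L$ such that $F_\lambda e_u \neq 0$, where $F_\lambda$ is the orthogonal projection onto the $\lambda$-eigenspace of $L$. For a graph $G$ on $\{v_1,\dots,v_n\}$ and an $n$-tuple $\mathbf{H} = (H_1,\dots,H_n)$ of graphs, the \emph{corona} $G\circ\mathbf{H}$ is the disjoint union of $G, H_1, \dots, H_n$ with an additional edge from $v_j$ to each vertex of $H_j$, for each $j$; the vertex $v_j$ of $G$, viewed in $G \circ \mathbf{H}$, is written $(v_j,0)$. \textbf{Theorem.}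 Let $G$ be a graph on $n$ vertices and let $\mathbf{H} = (H_1,\dots,H_n)$ be an $n$-tuple of graphs, each on $m \geq 1$ vertices. Suppose that $G$ has Laplacian perfect state transfer between vertices $u$ and $v$, and that $2^r$ (with $r \geq 0$ an integer) is the greatest power of two dividing each element of the eigenvalue support of $u$, the elements of which are in particular integers. If $2^{r+1}$ divides $m+1$, then $G \circ \mathbf{H}$ has Laplacian pretty good state transfer between $(u,0)$ and $(v,0)$. -/

import Mathlib

namespace LaplacianWalk

noncomputable section

/-- The (inhomogeneous) corona `G ∘ H` of a graph `G` with a family `H` of graphs, one for each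
vertex of `G`. The vertex `(v, 0)` is `⟨v, none⟩`, and the vertex `(v, w)` with `w` a vertex of
`H v` is `⟨v, some w⟩`. -/
def corona {V : Type*} {W : V → Type*} (G : SimpleGraph V) (H : ∀ v, SimpleGraph (W v)) :
    SimpleGraph (Σ v, Option (W v)) where
  Adj x y :=
    (x.2 = none ∧ y.2 = none ∧ G.Adj x.1 y.1) ∨
    (∃ (v : V) (w w' : W v), x = ⟨v, some w⟩ ∧ y = ⟨v, some w'⟩ ∧ (H v).Adj w w') ∨
    (x.1 = y.1 ∧ Xor (x.2 = none) (y.2 = none))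
  symm := by
    constructor
    rintro x y (⟨hx, hy, h⟩ | ⟨v, w, w', hx, hy, h⟩ | ⟨h, h'⟩)
    · exact Or.inl ⟨hy, hx, h.symm⟩
    · exact Or.inr (Or.inl ⟨v, w', w, hy, hx, h.symm⟩)
    · exact Or.inr (Or.inr ⟨h.symm, Or.symm h'⟩)
  loopless := by
    constructor
    rintro x (⟨_, _, h⟩ | ⟨v, w, w', hx, hy, h⟩ | ⟨_, h⟩)
    · exact G.loopless.irrefl _ h
    · subst hx
      simp only [Sigma.mk.injEq, heq_eq_eq, Option.some.injEq, true_and] at hy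
      subst hy
      exact (H v).loopless.irrefl _ h
    · rcases h with ⟨h1, h2⟩ | ⟨h1, h2⟩ <;> exact h2 h1

variable {V : Type*} [Fintype V] [DecidableEq V]

open Classical in
/-- The transition matrix `U(t) = exp(-i t L)`, where `L = D - A` is the Laplacian of `G`. -/
def transition (G : SimpleGraph V) (t : ℝ) : Matrix V V ℂ :=
  NormedSpace.exp ((-(Complex.I * (t : ℂ))) • G.lapMatrix ℂ)

/-- Laplacian perfect state transfer between `u` and `v`: at some time `τ` there is a complex
number `γ` with `U(τ) e_u = γ e_v`. -/
def HasPerfectStateTransfer (G : SimpleGraph V) (u v : V) : Prop :=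
  ∃ (τ : ℝ) (γ : ℂ),
    Matrix.mulVec (transition G τ) (Pi.single u 1) = γ • (Pi.single v 1 : V → ℂ)

/-- Laplacian pretty good state transfer between `u` and `v`: for each `ε > 0` there are a time
`t` and a complex number `γ` with `‖U(t) e_u - γ e_v‖ < ε` in the Euclidean norm. -/
def HasPrettyGoodStateTransfer (G : SimpleGraph V) (u v : V) : Prop :=
  ∀ ε : ℝ, 0 < ε → ∃ (t : ℝ) (γ : ℂ),
    ‖WithLp.toLp 2
      (Matrix.mulVec (transition G t) (Pi.single u 1) - γ • (Pi.single v 1 : V → ℂ))‖ < ε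

open Classical in
/-- The eigenspace of the Laplacian of `G` for the real number `μ`. -/
def lapEigenspace (G : SimpleGraph V) (μ : ℝ) : Submodule ℝ (EuclideanSpace ℝ V) :=
  Module.End.eigenspace (Matrix.toEuclideanLin (G.lapMatrix ℝ)) μ

/-- The eigenvalue support of the vertex `v`: the set of the Laplacian eigenvalues `μ` with
`F_μ e_v ≠ 0`, where `F_μ` is the orthogonal projection onto the eigenspace of `μ`. -/
def eigenvalueSupport (G : SimpleGraph V) (v : V) : Set ℝ :=
  {μ | lapEigenspace G μ ≠ ⊥ ∧
    (lapEigenspace G μ).starProjection (EuclideanSpace.single v 1) ≠ 0}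

/-- `2 ^ r` is the greatest power of two dividing each element of `S`. Divisibility is that of
integers, so it includes that the elements of `S` are integers. -/
def IsGreatestTwoPowDvd (S : Set ℝ) (r : ℕ) : Prop :=
  IsGreatest {k : ℕ | ∀ μ ∈ S, ∃ z : ℤ, μ = (z : ℝ) ∧ (2 : ℤ) ^ k ∣ z} r

end

end LaplacianWalk

/-! Vectors constant on each attached graph form a Laplacian-invariant subspace of the corona. There
an eigenvalue `μ` of `G` splits into `(m + 1 + μ ± Δ) / 2`, where `Δ` is `coronaGap m μ`. At time
`2πq / 2 ^ r` with `q` odd, the phase of the common part `(m + 1 + μ) / 2` is exactly `(-1) ^ k` for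
`μ = 2 ^ r * k`, since `2 ^ (r + 1) ∣ m + 1`. Perfect state transfer says that these signs carry
`e_u` to `e_v` (`exists_sign_decomposition`).

It remains to find an odd `q` bringing every `q * Δ / 2 ^ (r + 1)` close to an integer. A Weyl-type
average provides one unless an integer combination of the numbers `Δ / 2 ^ (r + 1)` is a
half-integer (`exists_odd_nsmul_norm_lt`). These numbers are integers for `μ = 0` and irrational
square roots of rationals otherwise (`irrational_coronaGap`), so a field trace rules this out
(`sum_int_mul_ne_add_half`). -/

/-! ### Odd multiples of a point of the torus. -/

open Filter Topology in
theorem tendsto_cesaro_pow_zero {w : ℂ} (hw : ‖w‖ = 1) (hw1 : w ≠ 1) :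
    Tendsto (fun N : ℕ ↦ (N : ℂ)⁻¹ * ∑ q ∈ Finset.range N, w ^ q) atTop (𝓝 0) := by
  rw [tendsto_zero_iff_norm_tendsto_zero]
  have h0 : Tendsto (fun N : ℕ ↦ (N : ℝ)⁻¹ * (2 / ‖w - 1‖)) atTop (𝓝 0) := by
    simpa using (tendsto_inv_atTop_nhds_zero_nat (𝕜 := ℝ)).mul_const (2 / ‖w - 1‖)
  refine squeeze_zero (fun _ ↦ norm_nonneg _) (fun N ↦ ?_) h0
  rw [norm_mul, norm_inv, Complex.norm_natCast, geom_sum_eq hw1, norm_div]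
  gcongr
  calc ‖w ^ N - 1‖ ≤ ‖w ^ N‖ + ‖(1 : ℂ)‖ := norm_sub_le _ _
    _ = 2 := by rw [norm_pow, hw]; norm_num

-- On a character the sum is geometric with ratio `-mFourier n x ≠ 1`. Trigonometric polynomials are
-- uniformly dense, and averaging does not increase the sup norm.
open Filter Topology UnitAddTorus in
theorem tendsto_cesaro_alternating {ι : Type*} [Fintype ι] {x : UnitAddTorus ι}
    (hx : ∀ n : ι → ℤ, mFourier n x ≠ -1) (f : C(UnitAddTorus ι, ℂ)) :
    Tendsto (fun N : ℕ ↦ (N : ℂ)⁻¹ * ∑ q ∈ Finset.range N, (-1) ^ q * f (q • x))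
      atTop (𝓝 0) := by
  have hmono (n : ι → ℤ) (q : ℕ) : mFourier n (q • x) = mFourier n x ^ q := by
    simp [mFourier, fourier_apply, Finset.prod_pow, smul_comm _ q, AddCircle.toCircle_nsmul]
  have hspan : ∀ p ∈ Submodule.span ℂ (Set.range (mFourier (d := ι))),
      Tendsto (fun N : ℕ ↦ (N : ℂ)⁻¹ * ∑ q ∈ Finset.range N, (-1) ^ q * p (q • x))
        atTop (𝓝 0) := by
    intro p hp
    induction hp using Submodule.span_induction with
    | mem p hp =>
      obtain ⟨n, rfl⟩ := hp
      simp_rw [hmono, ← mul_pow]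
      apply tendsto_cesaro_pow_zero
      · simp [mFourier, fourier_apply, norm_prod, Circle.norm_coe]
      · intro h
        exact hx n (by linear_combination -h)
    | zero => simp
    | add p p' _ _ h h' =>
      simpa [mul_add, Finset.sum_add_distrib] using h.add h'
    | smul a p _ h =>
      have := h.const_mul a
      rw [mul_zero] at this
      refine this.congr fun N ↦ ?_
      simp only [ContinuousMap.smul_apply, smul_eq_mul, Finset.mul_sum]
      exact Finset.sum_congr rfl fun q _ ↦ by ring
  have hf : f ∈ (Submodule.span ℂ (Set.range (mFourier (d := ι)))).topologicalClosure := by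
    rw [span_mFourier_closure_eq_top]; trivial
  rw [Metric.tendsto_atTop]
  intro ε hε
  obtain ⟨p, hp, hpf⟩ := Metric.mem_closure_iff.1 hf (ε / 2) (half_pos hε)
  obtain ⟨N₀, hN₀⟩ := Metric.tendsto_atTop.1 (hspan p hp) (ε / 2) (half_pos hε)
  refine ⟨N₀, fun N hN ↦ ?_⟩
  have h1 := hN₀ N hN
  rw [dist_zero_right] at h1 ⊢
  have h2 : ‖(N : ℂ)⁻¹ * ∑ q ∈ Finset.range N, (-1) ^ q * f (q • x) -
      (N : ℂ)⁻¹ * ∑ q ∈ Finset.range N, (-1) ^ q * p (q • x)‖ ≤ ε / 2 := by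
    rw [← mul_sub, ← Finset.sum_sub_distrib, norm_mul, norm_inv, Complex.norm_natCast]
    have h3 : ‖∑ q ∈ Finset.range N, ((-1) ^ q * f (q • x) - (-1) ^ q * p (q • x))‖ ≤
        N * (ε / 2) := by
      refine (norm_sum_le_of_le (Finset.range N) (n := fun _ ↦ ε / 2) fun q _ ↦ ?_).trans
        (by simp)
      rw [← mul_sub, norm_mul, norm_pow, norm_neg, norm_one, one_pow, one_mul]
      exact (ContinuousMap.norm_coe_le_norm (f - p) _).trans (by rw [← dist_eq_norm]; exact hpf.le)
    calc (N : ℝ)⁻¹ * _ ≤ (N : ℝ)⁻¹ * (N * (ε / 2)) := by gcongr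
      _ ≤ ε / 2 := by
        rw [← mul_assoc]
        exact mul_le_of_le_one_left (half_pos hε).le (inv_mul_le_one)
  calc _ ≤ _ := norm_le_norm_add_norm_sub' _ _
    _ < ε / 2 + ε / 2 := add_lt_add_of_lt_of_le h1 h2
    _ = ε := by ring

-- Otherwise the odd multiples stay `ε`-far from the even ones, and a continuous function equals
-- `(-1) ^ q` at each `q • x`. Its alternating average is then 1, not 0.
open Filter Topology UnitAddTorus in
theorem exists_odd_nsmul_norm_lt {ι : Type*} [Fintype ι] {x : UnitAddTorus ι}
    (hx : ∀ n : ι → ℤ, mFourier n x ≠ -1) {ε : ℝ} (hε : 0 < ε) :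
    ∃ q : ℕ, Odd q ∧ ‖q • x‖ < ε := by
  by_contra! hcon
  set A : Set (UnitAddTorus ι) := {z | ∃ q : ℕ, Even q ∧ z = q • x} with hA
  have hA0 : A.Nonempty := ⟨0, 0, by simp, by simp⟩
  let f : C(UnitAddTorus ι, ℂ) :=
    ⟨fun z ↦ ((1 - 2 * min 1 (Metric.infDist z A / ε) : ℝ) : ℂ), by
      have := Metric.continuous_infDist_pt A
      fun_prop⟩
  have hf (q : ℕ) : (-1) ^ q * f (q • x) = 1 := by
    rcases Nat.even_or_odd q with hq | hq
    · have : Metric.infDist (q • x) A = 0 := Metric.infDist_zero_of_mem ⟨q, hq, rfl⟩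
      simp [f, hq.neg_one_pow, this]
    · have : ε ≤ Metric.infDist (q • x) A := by
        rw [Metric.le_infDist hA0]
        rintro _ ⟨a, ha, rfl⟩
        rw [dist_eq_norm]
        rcases le_total a q with h | h
        · rw [← Nat.sub_add_cancel h, add_nsmul, add_sub_cancel_right]
          exact hcon _ (Nat.Odd.sub_even h hq ha)
        · rw [norm_sub_rev, ← Nat.sub_add_cancel h, add_nsmul, add_sub_cancel_right]
          exact hcon _ (Nat.Even.sub_odd h ha hq)
      have : min 1 (Metric.infDist (q • x) A / ε) = 1 := min_eq_left ((one_le_div hε).2 this)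
      simp only [f, hq.neg_one_pow, ContinuousMap.coe_mk, this]
      norm_num
  have h := tendsto_cesaro_alternating hx f
  simp_rw [hf] at h
  have h1 : Tendsto (fun N : ℕ ↦ (N : ℂ)⁻¹ * ∑ q ∈ Finset.range N, (1 : ℂ)) atTop (𝓝 1) := by
    refine tendsto_const_nhds.congr' ?_
    filter_upwards [eventually_ne_atTop 0] with N hN
    simp [hN]
  exact one_ne_zero (tendsto_nhds_unique h1 h)

/-! ### Excluding half-integer relations by the trace. -/

theorem trace_eq_zero_of_sq_eq {K L : Type*} [Field K] [Field L] [Algebra K L]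
    [FiniteDimensional K L] {x : L} {d : K} (hd : x ^ 2 = algebraMap K L d)
    (hx : ∀ a : K, x ≠ algebraMap K L a) : Algebra.trace K L x = 0 := by
  have hirr : Irreducible (Polynomial.X ^ 2 - Polynomial.C d) := by
    refine X_pow_sub_C_irreducible_of_prime Nat.prime_two fun b hb ↦ ?_
    rw [← hb, map_pow, sq_eq_sq_iff_eq_or_eq_neg, ← map_neg] at hd
    exact hd.elim (hx _) (hx _)
  have hmin : minpoly K x = Polynomial.X ^ 2 - Polynomial.C d :=
    (minpoly.eq_of_irreducible_of_monic hirr (by simp [hd])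
      (Polynomial.monic_X_pow_sub_C d two_ne_zero)).symm
  rw [trace_eq_finrank_mul_minpoly_nextCoeff, hmin, Polynomial.nextCoeff,
    Polynomial.natDegree_X_pow_sub_C]
  simp

/-- Take the trace to `ℚ` from the field generated by `y`: irrational square roots contribute 0,
integers contribute integer multiples of the degree. Dividing by the degree would make `k + 1 / 2`
an integer. -/
theorem sum_int_mul_ne_add_half {ι : Type*} [Fintype ι] {y : ι → ℝ}
    (hy : ∀ i, (∃ a : ℤ, y i = a) ∨ Irrational (y i) ∧ ∃ d : ℚ, y i ^ 2 = d)
    (n : ι → ℤ) (k : ℤ) : ∑ i, n i * y i ≠ k + 1 / 2 := by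
  intro h
  let K := IntermediateField.adjoin ℚ (Set.range y)
  have hint : ∀ x ∈ Set.range y, IsIntegral ℚ x := by
    rintro _ ⟨i, rfl⟩
    rcases hy i with ⟨a, ha⟩ | ⟨-, d, hd⟩
    · rw [ha]; simpa using isIntegral_algebraMap (R := ℚ) (A := ℝ) (x := (a : ℚ))
    · refine IsIntegral.of_pow two_pos ?_
      rw [hd]; exact isIntegral_algebraMap (R := ℚ) (A := ℝ) (x := d)
  have : FiniteDimensional ℚ K :=
    IntermediateField.finiteDimensional_adjoin hint
  let z : ι → K := fun i ↦ ⟨y i, IntermediateField.subset_adjoin _ _ ⟨i, rfl⟩⟩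
  have htr (i : ι) : ∃ a : ℤ, Algebra.trace ℚ K (z i) = Module.finrank ℚ K * a := by
    rcases hy i with ⟨a, ha⟩ | ⟨hirr, d, hd⟩
    · refine ⟨a, ?_⟩
      have : z i = algebraMap ℚ K a := Subtype.ext (by simp [z, ha])
      rw [this, Algebra.trace_algebraMap, nsmul_eq_mul]
    · refine ⟨0, ?_⟩
      rw [Int.cast_zero, mul_zero]
      refine trace_eq_zero_of_sq_eq (d := d) (Subtype.ext (by simpa [z] using hd)) fun a ha ↦ ?_
      exact hirr ⟨a, by simpa [z] using (congrArg Subtype.val ha).symm⟩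
  choose a ha using htr
  have hz : ∑ i, (n i : ℚ) • z i = algebraMap ℚ K (k + 1 / 2) := by
    refine Subtype.ext ?_
    simpa [z, Algebra.smul_def, show ((2 : K) : ℝ) = 2 from rfl] using h
  have htrace := congrArg (Algebra.trace ℚ K) hz
  simp only [map_sum, map_smul, ha, Algebra.trace_algebraMap, smul_eq_mul, nsmul_eq_mul] at htrace
  have hK : (Module.finrank ℚ K : ℚ) ≠ 0 := by
    exact_mod_cast (Module.finrank_pos (R := ℚ) (M := K)).ne'
  have h2 : (Module.finrank ℚ K : ℚ) * ∑ i, (n i : ℚ) * a i =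
      Module.finrank ℚ K * (k + 1 / 2) := by
    rw [← htrace, Finset.mul_sum]
    exact Finset.sum_congr rfl fun i _ ↦ by ring
  have h3 := mul_left_cancel₀ hK h2
  have h4 : ((2 * ∑ i, n i * a i : ℤ) : ℚ) = (2 * k + 1 : ℤ) := by
    push_cast
    linear_combination 2 * h3
  have h5 : 2 * ∑ i, n i * a i = 2 * k + 1 := by exact_mod_cast h4
  omega

open UnitAddTorus Complex in
theorem exists_odd_norm_exp_sub_one_lt {ι : Type*} [Fintype ι] {y : ι → ℝ}
    (hy : ∀ i, (∃ a : ℤ, y i = a) ∨ Irrational (y i) ∧ ∃ d : ℚ, y i ^ 2 = d)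
    {ε : ℝ} (hε : 0 < ε) :
    ∃ q : ℕ, Odd q ∧ ‖(fun i ↦ exp (2 * Real.pi * I * (q * y i))) - (1 : ι → ℂ)‖ < ε := by
  let x : UnitAddTorus ι := fun i ↦ (y i : UnitAddCircle)
  have hx (n : ι → ℤ) : mFourier n x ≠ -1 := by
    intro h
    simp only [mFourier, ContinuousMap.coe_mk, x, fourier_coe_apply, ofReal_one, div_one,
      ← exp_sum] at h
    rw [← exp_pi_mul_I, exp_eq_exp_iff_exists_int] at h
    obtain ⟨k, hk⟩ := h
    apply sum_int_mul_ne_add_half hy n k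
    have hpi : (2 * Real.pi * I : ℂ) ≠ 0 := two_pi_I_ne_zero
    have : (2 * Real.pi * I : ℂ) * ∑ i, (n i : ℂ) * y i = 2 * Real.pi * I * (k + 1 / 2) := by
      rw [Finset.mul_sum]
      simp_rw [← mul_assoc]
      rw [hk]; ring
    have := mul_left_cancel₀ hpi this
    apply ofReal_injective
    push_cast
    exact this
  let g : UnitAddTorus ι → ι → ℂ := fun z i ↦ fourier 1 (z i)
  have hg : Continuous g := by fun_prop
  obtain ⟨δ, hδ, hgδ⟩ := Metric.continuous_iff.1 hg 0 ε hε
  obtain ⟨q, hq, hqx⟩ := exists_odd_nsmul_norm_lt hx hδ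
  refine ⟨q, hq, ?_⟩
  have h := hgδ (q • x) (by rwa [dist_zero_right])
  have hg0 : g 0 = 1 := by ext i; simp [g]
  have hgq : g (q • x) = fun i ↦ exp (2 * Real.pi * I * (q * y i)) := by
    ext i
    have : (q • x) i = ((q * y i : ℝ) : UnitAddCircle) := by simp [x]
    simp only [g, this, fourier_coe_apply]
    congr 1; push_cast; ring
  rwa [hg0, hgq, dist_eq_norm] at h

/-! ### Eigenvectors of the Laplacian and their phases. -/

namespace LaplacianWalk

open scoped Matrix

section exp

attribute [local instance] Matrix.linftyOpNormedRing Matrix.linftyOpNormedAlgebra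

theorem exp_mulVec_of_mulVec_eq {n : Type*} [Fintype n] [DecidableEq n] {M : Matrix n n ℂ}
    {w : n → ℂ} {θ : ℂ} (h : M *ᵥ w = θ • w) :
    NormedSpace.exp M *ᵥ w = Complex.exp θ • w := by
  have hpow (k : ℕ) : M ^ k *ᵥ w = θ ^ k • w := by
    induction k with
    | zero => simp
    | succ k ih => rw [pow_succ, ← Matrix.mulVec_mulVec, h, Matrix.mulVec_smul, ih, smul_smul,
        pow_succ']
  have h1 := (NormedSpace.exp_series_hasSum_exp' (𝕂 := ℂ) M).map
    (Matrix.mulVecBilin ℂ ℂ |>.flip w) (by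
      change Continuous fun A : Matrix n n ℂ ↦ A *ᵥ w
      fun_prop)
  have h2 := (NormedSpace.exp_series_hasSum_exp' (𝕂 := ℂ) θ).smul_const w
  rw [← Complex.exp_eq_exp_ℂ] at h2
  refine h1.unique ?_
  convert h2 using 2 with k
  simp [hpow, smul_smul]

end exp

variable {V : Type*} [Fintype V] [DecidableEq V]

open Classical in
theorem transition_mulVec_of_mulVec_eq {G : SimpleGraph V} {w : V → ℂ} {θ : ℂ}
    (h : G.lapMatrix ℂ *ᵥ w = θ • w) (t : ℝ) :
    transition G t *ᵥ w = Complex.exp (-(Complex.I * t) * θ) • w :=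
  exp_mulVec_of_mulVec_eq (by rw [Matrix.smul_mulVec, h, smul_smul])

theorem lapMatrix_map_ofReal_mulVec (G : SimpleGraph V) [DecidableRel G.Adj] (f : V → ℝ) :
    G.lapMatrix ℂ *ᵥ (fun x ↦ (f x : ℂ)) = fun x ↦ ((G.lapMatrix ℝ *ᵥ f) x : ℂ) := by
  ext x
  simp [SimpleGraph.lapMatrix_mulVec_apply]

open Classical in
theorem transition_transpose (G : SimpleGraph V) (t : ℝ) :
    (transition G t)ᵀ = transition G t := by
  rw [transition, ← Matrix.exp_transpose, Matrix.transpose_smul, (G.isSymm_lapMatrix ℂ).eq]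

-- Pair the transfer identity bilinearly with `w`; since the transition matrix is symmetric, it can
-- act on `w` instead.
open Classical in
theorem exp_mul_eq_of_perfect {G : SimpleGraph V} {u v : V} {τ : ℝ} {γ : ℂ}
    (h : transition G τ *ᵥ Pi.single u 1 = γ • (Pi.single v 1 : V → ℂ))
    {w : V → ℂ} {θ : ℂ} (hw : G.lapMatrix ℂ *ᵥ w = θ • w) :
    Complex.exp (-(Complex.I * τ) * θ) * w u = γ * w v := by
  have h1 := congrArg (w ⬝ᵥ ·) h
  simp only [Matrix.dotProduct_mulVec, dotProduct_smul] at h1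
  rw [← Matrix.mulVec_transpose, transition_transpose, transition_mulVec_of_mulVec_eq hw] at h1
  simpa using h1

open Classical in
theorem lapEigenvalue_mem_eigenvalueSupport {G : SimpleGraph V} {u : V} {μ : ℝ}
    {b : EuclideanSpace ℝ V} (hb : G.lapMatrix ℝ *ᵥ ⇑b = μ • ⇑b) (hbu : b u ≠ 0) :
    μ ∈ eigenvalueSupport G u := by
  have hmem : b ∈ lapEigenspace G μ := by
    rw [lapEigenspace, Module.End.mem_eigenspace_iff]
    ext x
    simpa [Matrix.toLpLin_apply] using congrFun hb x
  refine ⟨fun h ↦ hbu ?_, fun h ↦ hbu ?_⟩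
  · rw [h, Submodule.mem_bot] at hmem
    simp [hmem]
  · have h1 := Submodule.starProjection_inner_eq_zero (K := lapEigenspace G μ)
      (EuclideanSpace.single u 1) b hmem
    rw [h, sub_zero] at h1
    simpa [EuclideanSpace.inner_single_left] using h1

open Classical in
theorem exists_eigenvector_of_mem_eigenvalueSupport {G : SimpleGraph V} {u : V} {μ : ℝ}
    (hμ : μ ∈ eigenvalueSupport G u) :
    ∃ f : V → ℝ, G.lapMatrix ℝ *ᵥ f = μ • f ∧ f u ≠ 0 := by
  set F := (lapEigenspace G μ).starProjection (EuclideanSpace.single u 1) with hF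
  have hmem : F ∈ lapEigenspace G μ := Submodule.starProjection_apply_mem _ _
  refine ⟨⇑F, ?_, fun h ↦ hμ.2 ?_⟩
  · rw [lapEigenspace, Module.End.mem_eigenspace_iff] at hmem
    ext x
    simpa [Matrix.toLpLin_apply] using congrArg (fun z : EuclideanSpace ℝ V ↦ z x) hmem
  · have h1 := Submodule.starProjection_inner_eq_zero (K := lapEigenspace G μ)
      (EuclideanSpace.single u 1) F hmem
    rw [← hF, inner_sub_left] at h1
    rw [← hF, ← inner_self_eq_zero (𝕜 := ℝ)]
    have h2 : inner ℝ (EuclideanSpace.single u (1 : ℝ)) F = 0 := by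
      simpa [EuclideanSpace.inner_single_left] using h
    linarith

open Classical in
theorem lapEigenvalue_nonneg {G : SimpleGraph V} {f : V → ℝ} {μ : ℝ}
    (hf : G.lapMatrix ℝ *ᵥ f = μ • f) (h0 : f ≠ 0) : 0 ≤ μ := by
  have h1 := (G.posSemidef_lapMatrix ℝ).dotProduct_mulVec_nonneg f
  rw [hf, dotProduct_smul, star_trivial, smul_eq_mul] at h1
  have h2 : 0 < f ⬝ᵥ f := by
    refine lt_of_le_of_ne (by simpa using dotProduct_star_self_nonneg f) fun h ↦ h0 ?_
    exact dotProduct_self_eq_zero.1 h.symm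
  exact nonneg_of_mul_nonneg_left h1 h2

-- Eigenvectors are real, so each phase at the transfer time is a sign. Comparing with one
-- eigenvalue `2 ^ r * k₀`, `k₀` odd, eliminates the time and identifies the sign as `(-1) ^ k`.
open Classical in
theorem exists_sign_decomposition {G : SimpleGraph V} {u v : V} (huv : u ≠ v)
    (hG : HasPerfectStateTransfer G u v) {r : ℕ}
    (hr : IsGreatestTwoPowDvd (eigenvalueSupport G u) r) :
    ∃ (f : V → V → ℝ) (k : V → ℕ),
      (∀ j, G.lapMatrix ℝ *ᵥ f j = ((2 : ℝ) ^ r * k j) • f j) ∧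
      ∑ j, f j = Pi.single u 1 ∧ ∑ j, (-1 : ℝ) ^ k j • f j = Pi.single v 1 := by
  obtain ⟨τ, γ, hτ⟩ := hG
  -- The constant vector has eigenvalue 0, hence phase 1.
  have hγ : γ = 1 := by
    have h := exp_mul_eq_of_perfect hτ (w := fun _ ↦ 1) (θ := 0)
      (by rw [SimpleGraph.lapMatrix_mulVec_const_eq_zero, zero_smul])
    simpa using h.symm
  subst hγ
  -- the phase of a real eigenvector at the transfer time is a sign
  have hphase {f : V → ℝ} {μ : ℝ} (hf : G.lapMatrix ℝ *ᵥ f = μ • f) :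
      Complex.exp (-(Complex.I * τ) * μ) * f u = f v := by
    have := exp_mul_eq_of_perfect hτ (w := fun x ↦ (f x : ℂ)) (θ := μ)
      (by rw [lapMatrix_map_ofReal_mulVec, hf]; ext x; simp)
    simpa using this
  have hsign {f : V → ℝ} {μ : ℝ} (hf : G.lapMatrix ℝ *ᵥ f = μ • f) (hu : f u ≠ 0) :
      ∃ n : ℤ, τ * μ = n * Real.pi ∧ f v = (-1) ^ n * f u := by
    have h := hphase hf
    have harg : -(Complex.I * τ) * μ = ((-(τ * μ) : ℝ) : ℂ) * Complex.I := by
      push_cast; ring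
    rw [harg] at h
    have him := congrArg Complex.im h
    have hre := congrArg Complex.re h
    rw [Complex.im_mul_ofReal, Complex.exp_ofReal_mul_I_im, Complex.ofReal_im, Real.sin_neg] at him
    rw [Complex.re_mul_ofReal, Complex.exp_ofReal_mul_I_re, Complex.ofReal_re, Real.cos_neg] at hre
    have hs : Real.sin (τ * μ) = 0 := by
      rcases mul_eq_zero.1 him with h | h
      · linarith
      · exact absurd h hu
    obtain ⟨n, hn⟩ := Real.sin_eq_zero_iff.1 hs
    refine ⟨n, hn.symm, ?_⟩
    rw [← hre, ← hn, Real.cos_int_mul_pi]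
  have hint {f : V → ℝ} {μ : ℝ} (hf : G.lapMatrix ℝ *ᵥ f = μ • f) (hu : f u ≠ 0) :
      ∃ k : ℕ, μ = 2 ^ r * k := by
    obtain ⟨z, hz, c, hc⟩ := hr.1 μ
      (lapEigenvalue_mem_eigenvalueSupport (b := WithLp.toLp 2 f) hf hu)
    have h0 := lapEigenvalue_nonneg hf (by rintro rfl; exact hu rfl)
    have hc0 : 0 ≤ c := by
      rw [hz, hc] at h0
      have : (0 : ℤ) ≤ 2 ^ r * c := by exact_mod_cast h0
      exact nonneg_of_mul_nonneg_right this (by positivity)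
    lift c to ℕ using hc0
    exact ⟨c, by rw [hz, hc]; push_cast; rfl⟩
  let hL := G.isHermitian_lapMatrix ℝ
  let b := hL.eigenvectorBasis
  have hb (j : V) : G.lapMatrix ℝ *ᵥ ⇑(b j) = hL.eigenvalues j • ⇑(b j) :=
    hL.mulVec_eigenvectorBasis j
  have hexp (x : V) : ∑ j, b j x • ⇑(b j) = Pi.single x (1 : ℝ) := by
    have := b.sum_repr (EuclideanSpace.single x 1)
    ext y
    have h := congrArg (fun z : EuclideanSpace ℝ V ↦ z y) this
    simpa [OrthonormalBasis.repr_apply_apply, Pi.single_apply,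
      EuclideanSpace.inner_single_right] using h
  -- some eigenvalue in the support is an odd multiple of `2 ^ r`
  obtain ⟨g, k₀, hg, hgu, hk₀⟩ : ∃ (g : V → ℝ) (k₀ : ℕ),
      G.lapMatrix ℝ *ᵥ g = ((2 : ℝ) ^ r * k₀) • g ∧ g u ≠ 0 ∧ Odd k₀ := by
    by_contra! hcon
    have : r + 1 ≤ r := hr.2 fun μ hμ ↦ by
      obtain ⟨f, hf, hfu⟩ := exists_eigenvector_of_mem_eigenvalueSupport hμ
      obtain ⟨k, rfl⟩ := hint hf hfu
      obtain ⟨c, hc⟩ := Nat.not_odd_iff_even.1 (hcon f k hf hfu)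
      exact ⟨2 ^ r * k, by push_cast; rfl, c, by rw [hc]; push_cast; ring⟩
    omega
  obtain ⟨n₀, hn₀, -⟩ := hsign hg hgu
  have hcross {f : V → ℝ} {k : ℕ} (hf : G.lapMatrix ℝ *ᵥ f = ((2 : ℝ) ^ r * k) • f) {n : ℤ}
      (hn : τ * (2 ^ r * k) = n * Real.pi) : n * k₀ = n₀ * k := by
    have : (n * k₀ : ℝ) * Real.pi = (n₀ * k) * Real.pi := by
      linear_combination k * hn₀ - k₀ * hn
    exact_mod_cast mul_right_cancel₀ Real.pi_ne_zero this
  -- If `n₀` were even, all signs would be `+1`, forcing `e_u = e_v`.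
  have hn₀odd : Odd n₀ := by
    by_contra hev
    rw [Int.not_odd_iff_even] at hev
    have hvu (j : V) : b j v = b j u := by
      by_cases hu : b j u = 0
      · have := hphase (hb j)
        rw [hu] at this ⊢
        simpa using this.symm
      · obtain ⟨k, hk⟩ := hint (hb j) hu
        obtain ⟨n, hn, hs⟩ := hsign (hb j) hu
        rw [hk] at hn
        have h := hcross (hk ▸ hb j) hn
        have hne : Even n := by
          have : Even (n * k₀) := h ▸ hev.mul_right _
          rcases Int.even_mul.1 this with h | h
          · exact h
          · exact absurd ((Int.even_coe_nat _).1 h) (Nat.not_even_iff_odd.2 hk₀)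
        rw [hs, hne.neg_one_zpow, one_mul]
    have h := hexp v
    simp_rw [hvu, hexp u] at h
    have := congrFun h u
    simp [huv] at this
  -- When `b j u = 0` the default `k = 0` is harmless: the component `b j u • b j` vanishes.
  have hk (j : V) : ∃ k : ℕ, (b j u ≠ 0 → hL.eigenvalues j = 2 ^ r * k) ∧
      b j v = (-1) ^ k * b j u := by
    by_cases hu : b j u = 0
    · have := hphase (hb j)
      rw [hu] at this
      exact ⟨0, fun h ↦ absurd hu h, by rw [hu]; simpa using this.symm⟩
    · obtain ⟨k, hk⟩ := hint (hb j) hu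
      obtain ⟨n, hn, hs⟩ := hsign (hb j) hu
      refine ⟨k, fun _ ↦ hk, ?_⟩
      rw [hk] at hn
      have h := hcross (hk ▸ hb j) hn
      rw [hs]
      congr 1
      have hpar : Even n ↔ Even k := by
        have h2 : Even (n * k₀) ↔ Even (n₀ * k) := by rw [h]
        rw [Int.even_mul, Int.even_mul, Int.even_coe_nat, Int.even_coe_nat] at h2
        have h3 := Nat.not_even_iff_odd.2 hk₀
        have h4 := Int.not_even_iff_odd.2 hn₀odd
        tauto
      rcases Nat.even_or_odd k with hk' | hk'
      · rw [hk'.neg_one_pow, (hpar.2 hk').neg_one_zpow]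
      · have : Odd n := Int.not_even_iff_odd.1 fun h ↦ Nat.not_even_iff_odd.2 hk' (hpar.1 h)
        rw [hk'.neg_one_pow, this.neg_one_zpow]
  choose k hk1 hk2 using hk
  refine ⟨fun j ↦ b j u • ⇑(b j), k, fun j ↦ ?_, hexp u, ?_⟩
  · by_cases hu : b j u = 0
    · simp [hu]
    · rw [Matrix.mulVec_smul, hb, hk1 j hu, smul_comm]
  · simp_rw [smul_smul, ← hk2]
    exact hexp v

theorem lapMatrix_mulVec_eq_sum_ite {X : Type*} [Fintype X] [DecidableEq X] (G : SimpleGraph X)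
    [DecidableRel G.Adj] (w : X → ℂ) (x : X) :
    (G.lapMatrix ℂ *ᵥ w) x = ∑ y, if G.Adj x y then w x - w y else 0 := by
  rw [SimpleGraph.lapMatrix_mulVec_apply, ← Finset.sum_filter, Finset.sum_sub_distrib,
    Finset.sum_const, nsmul_eq_mul]
  simp [SimpleGraph.neighborFinset_eq_filter, ← SimpleGraph.card_neighborFinset_eq_degree]

/-! ### The Laplacian of the corona. -/

section corona

variable {V : Type*} {W : V → Type*} {G : SimpleGraph V} {H : ∀ v, SimpleGraph (W v)}

theorem corona_adj_none_none {a b : V} :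
    (corona G H).Adj ⟨a, none⟩ ⟨b, none⟩ ↔ G.Adj a b := by
  refine ⟨?_, fun h ↦ Or.inl ⟨rfl, rfl, h⟩⟩
  rintro (⟨-, -, h⟩ | ⟨c, x, -, hx, -⟩ | ⟨-, ⟨-, h⟩ | ⟨-, h⟩⟩)
  · exact h
  · obtain ⟨rfl, hx⟩ := Sigma.mk.inj hx
    simp at hx
  · exact absurd rfl h
  · exact absurd rfl h

theorem corona_adj_none_some {a b : V} {w : W b} :
    (corona G H).Adj ⟨a, none⟩ ⟨b, some w⟩ ↔ a = b := by
  refine ⟨?_, fun h ↦ Or.inr (Or.inr ⟨h, Or.inl ⟨rfl, Option.some_ne_none w⟩⟩)⟩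
  rintro (⟨-, h, -⟩ | ⟨c, x, -, hx, -⟩ | ⟨h, -⟩)
  · simp at h
  · obtain ⟨rfl, hx⟩ := Sigma.mk.inj hx
    simp at hx
  · exact h

theorem eq_of_corona_adj_some_some {a b : V} {w : W a} {w' : W b}
    (h : (corona G H).Adj ⟨a, some w⟩ ⟨b, some w'⟩) : a = b := by
  rcases h with ⟨h, -⟩ | ⟨c, x, x', hx, hy, -⟩ | ⟨h, -⟩
  · simp at h
  · rw [Sigma.mk.injEq] at hx hy
    exact hx.1.trans hy.1.symm
  · exact h

/-- The vector on the corona equal to `g` on the base graph, and to the constant `h a` on the graph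
attached to the vertex `a`. -/
def coronaLift {V : Type*} (W : V → Type*) (g h : V → ℂ) (x : Σ v, Option (W v)) : ℂ :=
  x.2.elim (g x.1) fun _ ↦ h x.1

theorem coronaLift_smul (c : ℂ) (g h : V → ℂ) :
    coronaLift W (c • g) (c • h) = c • coronaLift W g h := by
  ext ⟨a, _ | w⟩ <;> simp [coronaLift]

variable [Fintype V] [DecidableEq V] [∀ v, Fintype (W v)] [∀ v, DecidableEq (W v)]

-- Edges inside an attached graph see a constant, so only its size `m` matters.
open Classical in
theorem corona_lapMatrix_mulVec_coronaLift {m : ℕ} (hW : ∀ v, Fintype.card (W v) = m)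
    (g h : V → ℂ) :
    (corona G H).lapMatrix ℂ *ᵥ coronaLift W g h =
      coronaLift W (G.lapMatrix ℂ *ᵥ g + (m : ℂ) • (g - h)) (h - g) := by
  ext ⟨a, _ | w⟩
  · rw [lapMatrix_mulVec_eq_sum_ite, Fintype.sum_sigma]
    simp_rw [Fintype.sum_option, corona_adj_none_none, corona_adj_none_some]
    simp only [coronaLift, Option.elim_none, Option.elim_some, Finset.sum_const, Finset.card_univ,
      hW, Finset.sum_add_distrib]
    rw [← lapMatrix_mulVec_eq_sum_ite]
    simp
  · rw [lapMatrix_mulVec_eq_sum_ite, Fintype.sum_sigma]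
    have h0 (b : V) (w' : W b) : (if (corona G H).Adj ⟨a, some w⟩ ⟨b, some w'⟩ then
        coronaLift W g h ⟨a, some w⟩ - coronaLift W g h ⟨b, some w'⟩ else 0) = 0 := by
      split_ifs with hadj
      · obtain rfl := eq_of_corona_adj_some_some hadj
        simp [coronaLift]
      · rfl
    have hns (b : V) : (corona G H).Adj ⟨a, some w⟩ ⟨b, none⟩ ↔ b = a := by
      rw [SimpleGraph.adj_comm, corona_adj_none_some]
    simp_rw [Fintype.sum_option, h0, hns]
    simp [coronaLift]

-- The eigenvalue equation is automatic on the attached graphs; on the base it is the quadratic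
-- `hθ`.
open Classical in
theorem corona_lapMatrix_mulVec_eigenvector {m : ℕ} (hW : ∀ v, Fintype.card (W v) = m)
    {f : V → ℂ} {μ θ : ℂ} (hf : G.lapMatrix ℂ *ᵥ f = μ • f)
    (hθ : θ ^ 2 - (m + 1 + μ) * θ + μ = 0) :
    (corona G H).lapMatrix ℂ *ᵥ coronaLift W ((1 - θ) • f) f =
      θ • coronaLift W ((1 - θ) • f) f := by
  rw [corona_lapMatrix_mulVec_coronaLift hW, ← coronaLift_smul, Matrix.mulVec_smul, hf]
  congr 1
  · ext x
    simp only [Pi.add_apply, Pi.smul_apply, Pi.sub_apply, smul_eq_mul]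
    linear_combination f x * hθ
  · ext x
    simp only [Pi.smul_apply, Pi.sub_apply, smul_eq_mul]
    ring

end corona

/-- The gap between the two eigenvalues of the corona that lie over the eigenvalue `μ`. -/
noncomputable def coronaGap (m : ℕ) (μ : ℝ) : ℝ :=
  √((m + 1) ^ 2 + 2 * (m - 1) * μ + μ ^ 2)

theorem coronaGap_sq_pos {m : ℕ} (hm : 1 ≤ m) {μ : ℝ} (hμ : 0 ≤ μ) :
    0 < (m + 1 : ℝ) ^ 2 + 2 * (m - 1) * μ + μ ^ 2 := by
  have : (1 : ℝ) ≤ m := by exact_mod_cast hm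
  have := mul_nonneg (sub_nonneg.2 this) hμ
  nlinarith

theorem coronaGap_pos {m : ℕ} (hm : 1 ≤ m) {μ : ℝ} (hμ : 0 ≤ μ) : 0 < coronaGap m μ :=
  Real.sqrt_pos.2 (coronaGap_sq_pos hm hμ)

theorem coronaGap_sq {m : ℕ} (hm : 1 ≤ m) {μ : ℝ} (hμ : 0 ≤ μ) :
    coronaGap m μ ^ 2 = (m + 1) ^ 2 + 2 * (m - 1) * μ + μ ^ 2 :=
  Real.sq_sqrt (coronaGap_sq_pos hm hμ).le

theorem coronaGap_zero (m : ℕ) : coronaGap m 0 = m + 1 := by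
  rw [coronaGap]
  convert Real.sqrt_sq (show (0 : ℝ) ≤ m + 1 by positivity) using 2
  ring

/-- The radicand `(l + m - 1) ^ 2 + 4 * m` lies strictly between `(l + m - 1) ^ 2` and `(l + m + 1)
^ 2`, and differs in parity from `(l + m) ^ 2`. -/
theorem irrational_coronaGap {m : ℕ} (hm : 1 ≤ m) {l : ℕ} (hl : l ≠ 0) :
    Irrational (coronaGap m l) := by
  obtain ⟨m, rfl⟩ := Nat.exists_eq_add_of_le' hm
  have : coronaGap (m + 1) l = √(((m + 2) ^ 2 + 2 * m * l + l ^ 2 : ℕ) : ℝ) := by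
    rw [coronaGap]; push_cast; ring_nf
  rw [this, irrational_sqrt_natCast_iff]
  rintro ⟨s, hs⟩
  have h1 : l + m < s := by nlinarith
  have h2 : s < l + m + 2 := by
    have := Nat.pos_of_ne_zero hl
    nlinarith
  obtain rfl : s = l + m + 1 := by omega
  have : 2 * m + 3 = 2 * l := by nlinarith
  omega

theorem exp_neg_pi_mul_I_mul_nat (n : ℕ) :
    Complex.exp (-(Real.pi * Complex.I) * n) = (-1) ^ n := by
  rw [mul_comm, Complex.exp_nat_mul, Complex.exp_neg, Complex.exp_pi_mul_I]
  norm_num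

end LaplacianWalk

/-! ### Assembling the transfer. -/

open LaplacianWalk Matrix in
theorem mainTheorem2 {V : Type*} [Fintype V] [DecidableEq V] (G : SimpleGraph V)
    {W : V → Type*} [∀ v, Fintype (W v)] [∀ v, DecidableEq (W v)]
    (H : ∀ v, SimpleGraph (W v)) (m : ℕ) (hm : 1 ≤ m) (hW : ∀ v, Fintype.card (W v) = m)
    (u v : V) (hG : LaplacianWalk.HasPerfectStateTransfer G u v)
    (r : ℕ)
    (hr : LaplacianWalk.IsGreatestTwoPowDvd (LaplacianWalk.eigenvalueSupport G u) r)
    (hdvd : 2 ^ (r + 1) ∣ m + 1) :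
    LaplacianWalk.HasPrettyGoodStateTransfer (LaplacianWalk.corona G H)
      ⟨u, none⟩ ⟨v, none⟩ := by
  classical
  intro ε hε
  -- For `u = v` the sign decomposition is not available, but time 0 works.
  rcases eq_or_ne u v with rfl | huv
  · exact ⟨0, 1, by simpa [transition, -mulVec_single] using hε⟩
  obtain ⟨f, k, hf, hfu, hfv⟩ := exists_sign_decomposition huv hG hr
  obtain ⟨c, hc⟩ := hdvd
  set l : V → ℕ := fun j ↦ 2 ^ r * k j with hl
  set Δ : V → ℝ := fun j ↦ coronaGap m (l j) with hΔ
  have hΔ0 (j : V) : (Δ j : ℂ) ≠ 0 :=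
    Complex.ofReal_ne_zero.2 (coronaGap_pos hm (Nat.cast_nonneg _)).ne'
  have hΔ2 (j : V) : (Δ j : ℂ) ^ 2 = (m + 1) ^ 2 + 2 * (m - 1) * l j + l j ^ 2 := by
    exact_mod_cast congrArg ((↑) : ℝ → ℂ) (coronaGap_sq hm (μ := l j) (Nat.cast_nonneg _))
  have hc' : (m : ℂ) + 1 = 2 * 2 ^ r * c := by
    have := congrArg ((↑) : ℕ → ℂ) hc
    push_cast at this
    rw [this]; ring
  let F : V → V → ℂ := fun j x ↦ f j x
  have hF (j : V) : G.lapMatrix ℂ *ᵥ F j = (l j : ℂ) • F j := by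
    rw [lapMatrix_map_ofReal_mulVec, hf]
    ext x
    simp [F, hl]
  let θ : ℂ → V → ℂ := fun σ j ↦ (m + 1 + l j + σ * Δ j) / 2
  let w : ℂ → V → (Σ v, Option (W v)) → ℂ := fun σ j ↦ coronaLift W ((1 - θ σ j) • F j) (F j)
  have hw {σ : ℂ} (hσ : σ ^ 2 = 1) (t : ℝ) (j : V) :
      transition (corona G H) t *ᵥ w σ j = Complex.exp (-(Complex.I * t) * θ σ j) • w σ j := by
    refine transition_mulVec_of_mulVec_eq (corona_lapMatrix_mulVec_eigenvector hW (hF j) ?_) t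
    simp only [θ]
    linear_combination (Δ j : ℂ) ^ 2 / 4 * hσ + hΔ2 j / 4
  -- The two eigenvectors over `l j` agree on the attached graphs, so their difference lives on the
  -- base.
  have hdiff (j : V) : w (-1) j - w 1 j = (Δ j : ℂ) • coronaLift W (F j) 0 := by
    ext ⟨a, _ | b⟩
    · simp [w, coronaLift, θ]; ring
    · simp [w, coronaLift]
  have hsum (s : V → ℂ) (x : V) (hx : ∑ j, s j • F j = Pi.single x 1) :
      ∑ j, (s j / Δ j) • (w (-1) j - w 1 j) = Pi.single ⟨x, none⟩ 1 := by
    simp_rw [hdiff, smul_smul, div_mul_cancel₀ _ (hΔ0 _)]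
    ext ⟨a, _ | b⟩
    · have := congrFun hx a
      simp only [Finset.sum_apply, Pi.smul_apply, smul_eq_mul] at this ⊢
      simp only [coronaLift, Option.elim_none, this, Pi.single_apply, Sigma.mk.injEq]
      by_cases hax : a = x
      · subst hax; simp
      · simp [hax]
    · have : (⟨a, some b⟩ : Σ v, Option (W v)) ≠ ⟨x, none⟩ := fun h ↦ by
        obtain ⟨rfl, h⟩ := Sigma.mk.inj h
        simp at h
      simp [coronaLift, Pi.single_eq_of_ne this]
  have hu := hsum 1 u (by
    ext x
    have := congrArg ((↑) : ℝ → ℂ) (congrFun hfu x)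
    simpa [F, Pi.single_apply, apply_ite] using this)
  have hv := hsum (fun j ↦ (-1) ^ k j) v (by
    ext x
    have := congrArg ((↑) : ℝ → ℂ) (congrFun hfv x)
    simpa [F, Pi.single_apply, apply_ite] using this)
  -- The state as a continuous function of the residual phases `z`; `z = 1` gives the target
  -- exactly.
  let Φ : (V → ℂ) → (Σ v, Option (W v)) → ℂ := fun z ↦
    ∑ j, ((-1) ^ k j / Δ j : ℂ) • (z j • w (-1) j - star (z j) • w 1 j)
  have hΦ1 : Φ 1 = Pi.single ⟨v, none⟩ 1 := by
    rw [← hv]; simp [Φ]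
  have hΦ : Continuous fun z ↦ WithLp.toLp 2 (Φ z) := by
    simp only [Φ]
    fun_prop
  obtain ⟨δ, hδ, hδΦ⟩ := Metric.continuous_iff.1 hΦ 1 ε hε
  have hy (j : V) : (∃ a : ℤ, Δ j / 2 ^ (r + 1) = a) ∨
      Irrational (Δ j / 2 ^ (r + 1)) ∧ ∃ d : ℚ, (Δ j / 2 ^ (r + 1)) ^ 2 = d := by
    by_cases h0 : l j = 0
    · refine Or.inl ⟨c, ?_⟩
      simp only [hΔ, h0, Nat.cast_zero, coronaGap_zero]
      rw [div_eq_iff (by positivity), mul_comm]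
      exact_mod_cast hc
    · refine Or.inr ⟨?_, ((m + 1) ^ 2 + 2 * (m - 1) * l j + l j ^ 2) / (2 ^ (r + 1)) ^ 2, ?_⟩
      · have := (irrational_coronaGap hm h0).div_natCast (m := 2 ^ (r + 1)) (by positivity)
        exact_mod_cast this
      · rw [div_pow, coronaGap_sq hm (Nat.cast_nonneg _)]
        push_cast
        rfl
  obtain ⟨q, hq, hqδ⟩ := exists_odd_norm_exp_sub_one_lt hy hδ
  set z : V → ℂ := fun j ↦
    Complex.exp (2 * Real.pi * Complex.I * (q * (Δ j / 2 ^ (r + 1) : ℝ))) with hz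
  -- Here `t * (m + 1 + l j) / 2 = π * q * (2 * c + k j)`, and `t * Δ j / 2` is the argument of `z
  -- j`.
  set t : ℝ := 2 * Real.pi * q / 2 ^ r with ht
  have hsign (j : V) :
      Complex.exp (-(Real.pi * Complex.I) * (q * (2 * c + k j) : ℕ)) = (-1) ^ k j := by
    rw [exp_neg_pi_mul_I_mul_nat, pow_mul, hq.neg_one_pow, pow_add, pow_mul]
    simp
  have hminus (j : V) :
      Complex.exp (-(Complex.I * t) * θ (-1) j) = (-1) ^ k j * z j := by
    rw [← hsign, hz, ← Complex.exp_add]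
    congr 1
    simp only [θ, ht, hl, hc']
    push_cast
    field_simp
    ring
  have hplus (j : V) :
      Complex.exp (-(Complex.I * t) * θ 1 j) = (-1) ^ k j * star (z j) := by
    rw [← hsign, hz, ← starRingEnd_apply, ← Complex.exp_conj, ← Complex.exp_add]
    congr 1
    simp only [θ, ht, hl, hc', map_mul, Complex.conj_I, Complex.conj_ofReal, map_natCast,
      map_ofNat]
    push_cast
    field_simp
    ring
  refine ⟨t, 1, ?_⟩
  have hUt : transition (corona G H) t *ᵥ Pi.single ⟨u, none⟩ 1 = Φ z := by
    rw [← hu, Matrix.mulVec_sum]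
    refine Finset.sum_congr rfl fun j _ ↦ ?_
    rw [Matrix.mulVec_smul, Matrix.mulVec_sub, hw (by norm_num), hw (by norm_num), hminus, hplus,
      ← smul_smul, ← smul_smul, ← smul_sub, smul_smul]
    congr 1
    simp; ring
  rw [hUt, one_smul, ← hΦ1, WithLp.toLp_sub, ← dist_eq_norm]
  exact hδΦ z (by rwa [dist_eq_norm])
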